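/- Let $X$ be a finite-dimensional $C^\infty$ manifold (without boundary) and let $\omega$ be a 2-plectic structure on $X$, i.e. a smooth 3-form with $d\omega=0$ and such that, for all $x\in X$ and $v\in T_xX$, $\iota_v\omega=\omega(v,\cdot,\cdot)=0$ implies $v=0$. Let $\mathrm{Ham}(X)$ be the real vector space of smooth 1-forms $F$ for which there is a smooth vector field $v_F$ (necessarily unique) with $dF=-\iota_{v_F}\omega$. A Lie 2-algebra is a 2-term complex of vector spaces $L_0\xleftarrow{\,d\,}L_1$ with: * a bracket, i.e. a chain map $[\cdot,\cdot]\colon L\otimes L\to L$; in components, bilinear maps $L_0\times L_0\to L_0$, $L_0\times L_1\to L_1$, $L_1\times L_0\to L_1$ with $d[x,f]=[x,df]$, $d[f,x]=[df,x]$, $[df,g]=[f,dg]$ for $x\in L_0$, $f,g\in L_1$ (the bracket of two 1-chains is $0$); * an alternator, i.e. a chain homotopy $S\colon[\cdot,\cdot]\Rightarrow-[\cdot,\cdot]\circ\sigma$, where $\sigma$ is the switch map; in components, a bilinear map $S\colon L_0\times L_0\to L_1$ with $[x,y]+dS_{x,y}=-[y,x]$, $[x,f]+S_{x,df}=-[f,x]$,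 $[f,x]+S_{df,x}=-[x,f]$; * a Jacobiator, i.e. an antisymmetric chain homotopy $J\colon[\cdot,[\cdot,\cdot]]\Rightarrow[[\cdot,\cdot],\cdot]+[\cdot,[\cdot,\cdot]]\circ(\sigma\otimes1)$; in components, an antisymmetric trilinear map $J\colon L_0^3\to L_1$ with $[x,[y,z]]+dJ_{x,y,z}=[[x,y],z]+[y,[x,z]]$ for $x,y,z\in L_0$, and, when one of $x,y,z$ is a 1-chain and the other two are 0-chains, $[x,[y,z]]+J'=[[x,y],z]+[y,[x,z]]$, where $J'$ is the value of $J$ after applying $d$ to the 1-chain; satisfying, for all $w,x,y,z\in L_0$, the coherence laws $$[J_{w,x,y},z]+J_{[w,y],x,z}+J_{w,[x,y],z}+[J_{w,y,z},x]+[w,J_{x,y,z}]=J_{[w,x],y,z}+[J_{w,x,z},y]+J_{w,[x,z],y}+J_{[w,z],x,y}+J_{w,x,[y,z]},$$ $$[S_{x,y},z]+J_{y,x,z}=-J_{x,y,z},\qquad [x,S_{y,z}]-J_{x,z,y}=J_{x,y,z}+S_{[x,y],z}+S_{y,[x,z]},\qquad S_{x,[y,z]}-S_{[y,z],x}=0.$$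 It is semistrict if $S=0$. Theorem. There is a semistrict Lie 2-algebra $L(X,\omega)_{\mathrm s}$ in which: * the space of 0-chains is $\mathrm{Ham}(X)$, the space of 1-chains is $C^\infty(X)$, and the differential is the exterior derivative $d\colon C^\infty(X)\to\mathrm{Ham}(X)$; * the bracket is the semi-bracket: $\{F,G\}_{\mathrm s}=\iota_{v_G}\iota_{v_F}\omega$ for $F,G\in\mathrm{Ham}(X)$, and $\{F,f\}_{\mathrm s}=\{f,F\}_{\mathrm s}=0$, $\{f,g\}_{\mathrm s}=0$ for $f,g\in C^\infty(X)$; in particular it is antisymmetric, $\{F,G\}_{\mathrm s}=-\{G,F\}_{\mathrm s}$; * the alternator is trivial, $S_{F,G}=0$; * the Jacobiator is $J_{F,G,H}=-\iota_{v_F}\iota_{v_G}\iota_{v_H}\omega$. -/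

import Mathlib

open scoped Manifold ContDiff

noncomputable section

section Forms

variable {E : Type*} [NormedAddCommGroup E] [NormedSpace ℝ E]
  {H : Type*} [TopologicalSpace H] (I : ModelWithCorners ℝ E H)
  (X : Type*) [TopologicalSpace X] [ChartedSpace H X]

/-- Not necessarily smooth differential `k`-forms on `X`: a choice of an alternating `k`-linear
form on each tangent space. -/
abbrev RawForm (k : ℕ) : Type _ := ∀ x : X, TangentSpace I x [⋀^Fin k]→L[ℝ] ℝ

variable {I X}

/-- The coordinate expression of a differential form in the preferred chart at `x₀`: its pullback
along the inverse of that chart. It is meaningful on the target of the chart. -/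
def RawForm.inChart {k : ℕ} (α : RawForm I X k) (x₀ : X) (y : E) : E [⋀^Fin k]→L[ℝ] ℝ :=
  (α ((extChartAt I x₀).symm y)).compContinuousLinearMap
    (mfderivWithin 𝓘(ℝ, E) I (extChartAt I x₀).symm (Set.range I) y)

/-- The exterior derivative. At `x` it is computed in the preferred chart at `x`, with the
convention `dα(v₀,…,v_k) = ∑ (-1)^i D_{v_i} α(v₀,…,v̂_i,…,v_k)` in coordinates. -/
def RawForm.extD {k : ℕ} (α : RawForm I X k) : RawForm I X (k + 1) := fun x =>
  (extDerivWithin (α.inChart x) (Set.range I) (extChartAt I x x)).compContinuousLinearMap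
    (mfderiv I 𝓘(ℝ, E) (extChartAt I x) x)

/-- The interior product `ι_v α = α(v, ·, …, ·)` at a point. -/
def interiorProd {k : ℕ} {x : X} (v : TangentSpace I x)
    (α : TangentSpace I x [⋀^Fin (k + 1)]→L[ℝ] ℝ) : TangentSpace I x [⋀^Fin k]→L[ℝ] ℝ :=
  ContinuousAlternatingMap.curryLeft (𝕜 := ℝ) (E := E) (F := ℝ) α v

theorem interiorProd_apply {k : ℕ} {x : X} (v : TangentSpace I x)
    (α : TangentSpace I x [⋀^Fin (k + 1)]→L[ℝ] ℝ) (w : Fin k → TangentSpace I x) :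
    interiorProd v α w = α (Matrix.vecCons v w) := rfl

theorem interiorProd_add {k : ℕ} {x : X} (v w : TangentSpace I x)
    (α : TangentSpace I x [⋀^Fin (k + 1)]→L[ℝ] ℝ) :
    interiorProd (v + w) α = interiorProd v α + interiorProd w α :=
  map_add (ContinuousAlternatingMap.curryLeft (𝕜 := ℝ) (E := E) (F := ℝ) α) v w

theorem interiorProd_smul {k : ℕ} {x : X} (c : ℝ) (v : TangentSpace I x)
    (α : TangentSpace I x [⋀^Fin (k + 1)]→L[ℝ] ℝ) :
    interiorProd (c • v) α = c • interiorProd v α :=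
  map_smul (ContinuousAlternatingMap.curryLeft (𝕜 := ℝ) (E := E) (F := ℝ) α) c v

theorem RawForm.inChart_add {k : ℕ} (α β : RawForm I X k) (x₀ : X) :
    (α + β).inChart x₀ = α.inChart x₀ + β.inChart x₀ := by
  funext y; ext v; rfl

theorem RawForm.inChart_smul {k : ℕ} (c : ℝ) (α : RawForm I X k) (x₀ : X) :
    (c • α).inChart x₀ = c • α.inChart x₀ := by
  funext y; ext v; rfl

variable (I X)

/-- The space of smooth differential `k`-forms: those whose coordinate expressions are
`C^∞`. -/
def SmoothForm (k : ℕ) : Submodule ℝ (RawForm I X k) where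
  carrier := {α | ∀ x₀ : X, ContDiffOn ℝ ∞ (α.inChart x₀) (extChartAt I x₀).target}
  add_mem' {α β} hα hβ x₀ := by
    rw [RawForm.inChart_add]; exact (hα x₀).add (hβ x₀)
  zero_mem' x₀ := by
    have h : (0 : RawForm I X k).inChart x₀ = fun _ => 0 := by funext y; ext v; rfl
    rw [h]; exact contDiffOn_const
  smul_mem' c α hα x₀ := by
    rw [RawForm.inChart_smul]; exact contDiffOn_const.smul (hα x₀)

/-- The smooth vector fields on a smooth manifold `X`. -/
abbrev SmoothVectorField [IsManifold I ∞ X] : Type _ := Cₛ^∞⟮I; E, (TangentSpace I : X → Type _)⟯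

variable {I X}

theorem RawForm.differentiableWithinAt_inChart {k : ℕ} {α : RawForm I X k}
    (hα : α ∈ SmoothForm I X k) (x : X) :
    DifferentiableWithinAt ℝ (α.inChart x) (Set.range I) (extChartAt I x x) :=
  ((hα x _ (mem_extChartAt_target x)).differentiableWithinAt (by simp)).mono_of_mem_nhdsWithin
    (extChartAt_target_mem_nhdsWithin x)

theorem RawForm.extD_add {k : ℕ} {α β : RawForm I X k} (hα : α ∈ SmoothForm I X k)
    (hβ : β ∈ SmoothForm I X k) : (α + β).extD = α.extD + β.extD := by
  funext x
  have hu : UniqueDiffWithinAt ℝ (Set.range I) (extChartAt I x x) :=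
    I.uniqueDiffOn _ (by simp [extChartAt])
  simp only [RawForm.extD, RawForm.inChart_add, Pi.add_apply]
  rw [extDerivWithin_add hu (RawForm.differentiableWithinAt_inChart hα x)
    (RawForm.differentiableWithinAt_inChart hβ x)]
  rfl

theorem RawForm.extD_smul {k : ℕ} (c : ℝ) (α : RawForm I X k) : (c • α).extD = c • α.extD := by
  funext x
  have hu : UniqueDiffWithinAt ℝ (Set.range I) (extChartAt I x x) :=
    I.uniqueDiffOn _ (by simp [extChartAt])
  simp only [RawForm.extD, RawForm.inChart_smul, Pi.smul_apply]
  rw [extDerivWithin_smul c _ hu]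
  rfl

/-- An `(n+1)`-form `Ω` is an `n`-plectic structure if it is smooth, closed and nondegenerate. -/
structure IsPlectic (n : ℕ) (Ω : RawForm I X (n + 1)) : Prop where
  smooth : Ω ∈ SmoothForm I X (n + 1)
  closed : Ω.extD = 0
  nondegenerate : ∀ (x : X) (v : TangentSpace I x), interiorProd v (Ω x) = 0 → v = 0

variable [IsManifold I ∞ X]

/-- `v` is a Hamiltonian vector field of the form `F`: `dF = -ι_v Ω`. -/
def IsHamiltonianVF {k : ℕ} (Ω : RawForm I X (k + 2)) (F : RawForm I X k)
    (v : SmoothVectorField I X) : Prop :=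
  ∀ x : X, F.extD x = -interiorProd (v x) (Ω x)

/-- The vector space `Ham(X)` of Hamiltonian forms: the smooth forms that have a smooth
Hamiltonian vector field. -/
def Ham {k : ℕ} (Ω : RawForm I X (k + 2)) : Submodule ℝ (RawForm I X k) where
  carrier := {F | F ∈ SmoothForm I X k ∧ ∃ v : SmoothVectorField I X, IsHamiltonianVF Ω F v}
  add_mem' {F G} := by
    rintro ⟨hF, v, hv⟩ ⟨hG, w, hw⟩
    refine ⟨add_mem hF hG, v + w, fun x => ?_⟩
    rw [RawForm.extD_add hF hG, Pi.add_apply, hv x, hw x, ContMDiffSection.coe_add, Pi.add_apply,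
      interiorProd_add, neg_add]
  zero_mem' := by
    refine ⟨zero_mem _, 0, fun x => ?_⟩
    have h := congrFun (RawForm.extD_smul (0 : ℝ) (0 : RawForm I X k)) x
    rw [zero_smul, Pi.smul_apply, zero_smul] at h
    have h' := interiorProd_smul (0 : ℝ) (0 : TangentSpace I x) (Ω x)
    rw [zero_smul, zero_smul] at h'
    rw [h, ContMDiffSection.coe_zero, Pi.zero_apply, h', neg_zero]
  smul_mem' c F := by
    rintro ⟨hF, v, hv⟩
    refine ⟨Submodule.smul_mem _ c hF, c • v, fun x => ?_⟩
    rw [RawForm.extD_smul, Pi.smul_apply, hv x, ContMDiffSection.coe_smul, Pi.smul_apply,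
      interiorProd_smul, smul_neg]

/-- The Hamiltonian vector field `v_F` of a Hamiltonian form `F`. -/
def hamVF {k : ℕ} {Ω : RawForm I X (k + 2)} (F : Ham Ω) : SmoothVectorField I X :=
  Classical.choose F.2.2

theorem hamVF_spec {k : ℕ} {Ω : RawForm I X (k + 2)} (F : Ham Ω) :
    IsHamiltonianVF Ω F.1 (hamVF F) :=
  Classical.choose_spec F.2.2

/-- When `Ω` is nondegenerate, `v_F` is the only Hamiltonian vector field of `F`. -/
theorem eq_hamVF {k : ℕ} {Ω : RawForm I X (k + 2)} (hΩ : IsPlectic (k + 1) Ω) (F : Ham Ω)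
    (v : SmoothVectorField I X) (hv : IsHamiltonianVF Ω F.1 v) : v = hamVF F := by
  ext x
  have h : interiorProd (v x) (Ω x) = interiorProd (hamVF F x) (Ω x) :=
    neg_injective ((hv x).symm.trans (hamVF_spec F x))
  have h2 : interiorProd (v x + (-1 : ℝ) • hamVF F x) (Ω x) = 0 := by
    rw [interiorProd_add, interiorProd_smul, h]
    exact (congrArg _ (neg_one_smul ℝ _)).trans (add_neg_cancel _)
  have h3 := hΩ.nondegenerate x _ h2
  rwa [neg_one_smul, add_neg_eq_zero] at h3

end Forms

/-- A Lie 2-algebra on a 2-term complex of vector spaces `L₀ ← L₁`, written in components.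
A 1-chain `T` is an arrow `x ⟶ x + dT`, and composing arrows adds the 1-chains; a commuting diagram
is thus an equality between the sums of the 1-chains along its two sides. -/
structure LieTwoAlgebra (K L₀ L₁ : Type*) [Field K] [AddCommGroup L₀] [Module K L₀]
    [AddCommGroup L₁] [Module K L₁] where
  /-- the differential -/
  d : L₁ →ₗ[K] L₀
  /-- the bracket of two 0-chains -/
  br : L₀ →ₗ[K] L₀ →ₗ[K] L₀
  /-- the bracket of a 0-chain and a 1-chain -/
  brR : L₀ →ₗ[K] L₁ →ₗ[K] L₁
  /-- the bracket of a 1-chain and a 0-chain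
  (the bracket of two 1-chains has degree 2, hence vanishes) -/
  brL : L₁ →ₗ[K] L₀ →ₗ[K] L₁
  /-- the bracket is a chain map on `L₀ ⊗ L₁` -/
  d_brR : ∀ x f, d (brR x f) = br x (d f)
  /-- the bracket is a chain map on `L₁ ⊗ L₀` -/
  d_brL : ∀ f x, d (brL f x) = br (d f) x
  /-- the bracket is a chain map on `L₁ ⊗ L₁`, where `d (f ⊗ g) = df ⊗ g - f ⊗ dg` -/
  brR_d : ∀ f g, brR (d f) g - brL f (d g) = 0
  /-- the alternator -/
  S : L₀ →ₗ[K] L₀ →ₗ[K] L₁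
  /-- the alternator is a chain homotopy from `[·,·]` to `-[·,·] ∘ σ`: degree 0 -/
  S_homotopy : ∀ x y, br x y + d (S x y) = -br y x
  /-- the same in degree 1, on `L₀ ⊗ L₁` -/
  S_homotopy_right : ∀ x f, brR x f + S x (d f) = -brL f x
  /-- the same in degree 1, on `L₁ ⊗ L₀` -/
  S_homotopy_left : ∀ f x, brL f x + S (d f) x = -brR x f
  /-- the Jacobiator -/
  J : L₀ →ₗ[K] L₀ →ₗ[K] L₀ →ₗ[K] L₁
  /-- the Jacobiator is a chain homotopy from `[·,[·,·]]` to
  `[[·,·],·] + [·,[·,·]] ∘ (σ ⊗ 1)`: degree 0 -/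
  J_homotopy : ∀ x y z, br x (br y z) + d (J x y z) = br (br x y) z + br y (br x z)
  /-- the same in degree 1, on `L₀ ⊗ L₀ ⊗ L₁` -/
  J_homotopy_right : ∀ x y f,
    brR x (brR y f) + J x y (d f) = brR (br x y) f + brR y (brR x f)
  /-- the same in degree 1, on `L₀ ⊗ L₁ ⊗ L₀` -/
  J_homotopy_mid : ∀ x f z,
    brR x (brL f z) + J x (d f) z = brL (brR x f) z + brL f (br x z)
  /-- the same in degree 1, on `L₁ ⊗ L₀ ⊗ L₀` -/
  J_homotopy_left : ∀ f y z,
    brL f (br y z) + J (d f) y z = brL (brL f y) z + brR y (brL f z)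
  /-- the Jacobiator is antisymmetric -/
  J_swap_left : ∀ x y z, J x y z = -J y x z
  J_swap_right : ∀ x y z, J x y z = -J x z y
  /-- the coherence law for four 0-chains -/
  jacobiator_coherence : ∀ w x y z,
    brL (J w x y) z + (J (br w y) x z + J w (br x y) z) + brL (J w y z) x + brR w (J x y z) =
      J (br w x) y z + brL (J w x z) y
        + (J w (br x z) y + J (br w z) x y + J w x (br y z))
  /-- the triangle with vertices `[[x,y],z]`, `-[[y,x],z]`, `[x,[y,z]] - [y,[x,z]]` -/
  alternator_jacobiator_left : ∀ x y z, brL (S x y) z + J y x z = -J x y z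
  /-- the square with vertices `[x,[y,z]]`, `-[x,[z,y]]`, `[[x,y],z] + [y,[x,z]]`,
  `-[[x,z],y] - [z,[x,y]]` -/
  alternator_jacobiator_right : ∀ x y z,
    brR x (S y z) - J x z y = J x y z + (S (br x y) z + S y (br x z))
  /-- the triangle with vertices `[x,[y,z]]`, `-[[y,z],x]`, `[x,[y,z]]` -/
  alternator_symm : ∀ x y z, S x (br y z) - S (br y z) x = 0

/-- A Lie 2-algebra is semistrict if its alternator is the identity chain homotopy, that is, the
arrow `S x y` is given by the 1-chain `0`. -/
def LieTwoAlgebra.IsSemistrict {K L₀ L₁ : Type*} [Field K] [AddCommGroup L₀] [Module K L₀]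
    [AddCommGroup L₁] [Module K L₁] (L : LieTwoAlgebra K L₀ L₁) : Prop :=
  ∀ x y, L.S x y = 0

end

/-!
Since `Ω` is closed and `dι_{v_F}Ω = -ddF = 0`, Cartan's formula `L_v = dι_v + ι_v d` gives
`L_{v_F}Ω = 0`. With `L_v ι_w = ι_{[v,w]} + ι_w L_v` it follows that
`d(ι_{v_F} ι_{v_G} Ω) = L_{v_F} ι_{v_G} Ω = ι_{[v_F,v_G]} Ω`, so `{F,G} = ι_{v_G} ι_{v_F} Ω` has the
Hamiltonian vector field `[v_F,v_G]`, and that `L_{v_F}` is a derivation of the semi-bracket.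

The Jacobiator is `J_{F,G,K} = ι_{v_F}{G,K}`. Since `ι_{v_F} d{G,K} = {F,{G,K}}`, Cartan's formula
for `L_{v_F}{G,K}` is the Jacobi identity up to `dJ_{F,G,K}`. The coherence law compares two
expressions for `L_{v_F} J_{G,K,L}`: the one given by the derivation property, and
`ι_{v_F} dJ_{G,K,L}`, which is found by contracting the Jacobi identity with `v_F`.
-/

noncomputable section

section CartanCalculus

open ContinuousAlternatingMap Topology VectorField

variable {𝕜 : Type*} [NontriviallyNormedField 𝕜]
  {E F : Type*} [NormedAddCommGroup E] [NormedSpace 𝕜 E] [NormedAddCommGroup F] [NormedSpace 𝕜 F]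
  {n : ℕ} {s : Set E} {x : E} {a b : E → E}

theorem inverse_apply_of_eq_id {T : E →L[𝕜] E} (hT : T = .id 𝕜 E) (u : E) : T.inverse u = u := by
  rw [hT, ContinuousLinearMap.inverse_id, ContinuousLinearMap.id_apply]

theorem compContinuousLinearMap_of_eq_id {T : E →L[𝕜] E} (hT : T = .id 𝕜 E)
    (β : E [⋀^Fin n]→L[𝕜] F) : β.compContinuousLinearMap T = β := by
  rw [hT]
  rfl

theorem curryLeft_curryLeft_swap (β : E [⋀^Fin (n + 2)]→L[𝕜] F) (u w : E) :
    (β.curryLeft u).curryLeft w = -(β.curryLeft w).curryLeft u := by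
  have h := curryLeft_same β (u + w)
  simp only [map_add, curryLeft_add, _root_.add_apply, curryLeft_same, zero_add, add_zero] at h
  exact eq_neg_of_add_eq_zero_right h

variable (𝕜 E F n) in
/-- `α ↦ (u ↦ ι_u α)` as a continuous linear map, so that the calculus of continuous bilinear maps
applies to interior products. -/
def curryLeftCLM : (E [⋀^Fin (n + 1)]→L[𝕜] F) →L[𝕜] E →L[𝕜] E [⋀^Fin n]→L[𝕜] F :=
  curryLeftLI.toContinuousLinearMap

@[simp]
theorem curryLeftCLM_apply (α : E [⋀^Fin (n + 1)]→L[𝕜] F) : curryLeftCLM 𝕜 E F n α = α.curryLeft :=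
  rfl

theorem curryLeft_alternatizeUncurryFin (f : E →L[𝕜] E [⋀^Fin (n + 1)]→L[𝕜] F) (u : E) :
    (alternatizeUncurryFin f).curryLeft u =
      f u - alternatizeUncurryFin ((curryLeftCLM 𝕜 E F n).flip u ∘L f) := by
  ext v
  have removeNth_cons (i : Fin (n + 1)) :
      i.succ.removeNth (Fin.cons u v : Fin (n + 2) → E) = Fin.cons u (i.removeNth v) := by
    ext j; cases j using Fin.cases <;> simp [Fin.removeNth]
  simp [alternatizeUncurryFin_apply, Fin.sum_univ_succ (n := n + 1), sub_eq_add_neg, pow_succ,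
    Matrix.vecCons, removeNth_cons]

theorem curryLeft_alternatizeUncurryFin_zero (f : E →L[𝕜] E [⋀^Fin 0]→L[𝕜] F) (u : E) :
    (alternatizeUncurryFin f).curryLeft u = f u := by
  ext v
  simp [alternatizeUncurryFin_apply, Subsingleton.elim _ v]

theorem contDiffOn_curryLeft {m : WithTop ℕ∞} {α : E → E [⋀^Fin (n + 1)]→L[𝕜] F}
    (hα : ContDiffOn 𝕜 m α s) (ha : ContDiffOn 𝕜 m a s) :
    ContDiffOn 𝕜 m (fun y => (α y).curryLeft (a y)) s :=
  have h : ContDiffOn 𝕜 m (fun y => (α y).curryLeft) s :=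
    ContDiff.comp_contDiffOn (g := curryLeftCLM 𝕜 E F n) (ContinuousLinearMap.contDiff _) hα
  h.clm_apply ha

/-- The Lie derivative `L_a α` within `s` of a form on a vector space: at `x`, its value on
`(w₁, …, w_n)` is `(D_{a x} α)(w₁, …, w_n) + ∑ i, α(w₁, …, D_{w_i} a, …, w_n)`. -/
def lieDerivWithin (a : E → E) (α : E → E [⋀^Fin n]→L[𝕜] F) (s : Set E) (x : E) :
    E [⋀^Fin n]→L[𝕜] F :=
  fderivWithin 𝕜 α s x (a x) +
    (α x).fderivCompContinuousLinearMap (.id 𝕜 E) (fderivWithin 𝕜 a s x)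

theorem hasFDerivWithinAt_curryLeft {α : E → E [⋀^Fin (n + 1)]→L[𝕜] F}
    (hα : DifferentiableWithinAt 𝕜 α s x) (ha : DifferentiableWithinAt 𝕜 a s x) :
    HasFDerivWithinAt (fun y => (α y).curryLeft (a y))
      ((α x).curryLeft ∘L fderivWithin 𝕜 a s x +
        (curryLeftCLM 𝕜 E F n).flip (a x) ∘L fderivWithin 𝕜 α s x) s x :=
  have h : HasFDerivWithinAt (fun y => (α y).curryLeft)
      (curryLeftCLM 𝕜 E F n ∘L fderivWithin 𝕜 α s x) s x :=
    HasFDerivAt.comp_hasFDerivWithinAt (g := curryLeftCLM 𝕜 E F n) x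
      (curryLeftCLM 𝕜 E F n).hasFDerivAt hα.hasFDerivWithinAt
  h.clm_apply ha.hasFDerivWithinAt

theorem lieDerivWithin_congr {α β : E → E [⋀^Fin n]→L[𝕜] F} (h : α =ᶠ[𝓝[s] x] β) (hx : x ∈ s) :
    lieDerivWithin a α s x = lieDerivWithin a β s x := by
  rw [lieDerivWithin, lieDerivWithin, h.fderivWithin_eq_of_mem hx, h.eq_of_nhdsWithin hx]

theorem extDerivWithin_curryLeft_add {α : E → E [⋀^Fin (n + 1)]→L[𝕜] F}
    (hα : DifferentiableWithinAt 𝕜 α s x) (ha : DifferentiableWithinAt 𝕜 a s x)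
    (hs : UniqueDiffWithinAt 𝕜 s x) :
    extDerivWithin (fun y => (α y).curryLeft (a y)) s x + (extDerivWithin α s x).curryLeft (a x) =
      lieDerivWithin a α s x := by
  have h : (α x).fderivCompContinuousLinearMap (.id 𝕜 E) (fderivWithin 𝕜 a s x) =
      alternatizeUncurryFin ((α x).curryLeft ∘L fderivWithin 𝕜 a s x) := by
    rw [fderivCompContinuousLinearMap_eq_alternatizeUncurryFin]
    rfl
  rw [extDerivWithin, (hasFDerivWithinAt_curryLeft hα ha).fderivWithin hs, extDerivWithin,
    curryLeft_alternatizeUncurryFin, alternatizeUncurryFin_add, lieDerivWithin, h]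
  abel

theorem extDerivWithin_curryLeft_zero (a : E → E) (α : E → E [⋀^Fin 0]→L[𝕜] F) :
    (extDerivWithin α s x).curryLeft (a x) = lieDerivWithin a α s x := by
  rw [extDerivWithin, curryLeft_alternatizeUncurryFin_zero]
  ext v
  simp [lieDerivWithin]

theorem curryLeft_fderivCompContinuousLinearMap (f : E [⋀^Fin (n + 1)]→L[𝕜] F) (A : E →L[𝕜] E)
    (u : E) :
    (f.fderivCompContinuousLinearMap (.id 𝕜 E) A).curryLeft u =
      f.curryLeft (A u) + (f.curryLeft u).fderivCompContinuousLinearMap (.id 𝕜 E) A := by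
  ext v
  simp only [curryLeft_apply_apply, fderivCompContinuousLinearMap_apply,
    Fin.sum_univ_succ (n := n), ContinuousAlternatingMap.add_apply]
  congr 2
  · ext j; cases j using Fin.cases <;> simp
  · ext i; congr; ext j; cases j using Fin.cases <;> simp [Function.update_apply, eq_comm]

theorem lieDerivWithin_curryLeft {α : E → E [⋀^Fin (n + 1)]→L[𝕜] F}
    (hα : DifferentiableWithinAt 𝕜 α s x) (hb : DifferentiableWithinAt 𝕜 b s x)
    (hs : UniqueDiffWithinAt 𝕜 s x) :
    lieDerivWithin a (fun y => (α y).curryLeft (b y)) s x =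
      (α x).curryLeft (lieBracketWithin 𝕜 a b s x) + (lieDerivWithin a α s x).curryLeft (b x) := by
  rw [lieDerivWithin, lieDerivWithin, (hasFDerivWithinAt_curryLeft hα hb).fderivWithin hs,
    curryLeft_add, _root_.add_apply, _root_.add_apply, curryLeft_fderivCompContinuousLinearMap,
    lieBracketWithin, map_sub]
  simp only [ContinuousLinearMap.comp_apply, ContinuousLinearMap.flip_apply, curryLeftCLM_apply]
  abel

end CartanCalculus

section Charts

open Set Topology VectorField ContinuousAlternatingMap

variable {E : Type*} [NormedAddCommGroup E] [NormedSpace ℝ E]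
  {H : Type*} [TopologicalSpace H] {I : ModelWithCorners ℝ E H}
  {X : Type*} [TopologicalSpace X] [ChartedSpace H X] {k : ℕ}

theorem minSmoothness_real_two_le_infty : minSmoothness ℝ 2 ≤ (∞ : WithTop ℕ∞) := by
  rw [minSmoothness_of_isRCLikeNormedField]
  exact WithTop.coe_le_coe.2 (le_top : (2 : ℕ∞) ≤ ⊤)

/-- The coordinate expression of a vector field in the preferred chart at `x₀`. -/
def vectorFieldInChart (v : ∀ x : X, TangentSpace I x) (x₀ : X) : E → E :=
  mpullbackWithin 𝓘(ℝ, E) I (extChartAt I x₀).symm v (range I)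

namespace RawForm

theorem apply_congr (α : RawForm I X k) {p q : X} (h : p = q) :
    (α p : E [⋀^Fin k]→L[ℝ] ℝ) = α q := by
  subst h; rfl

/-- The interior product `ι_v α` with a vector field. -/
def interior (α : RawForm I X (k + 1)) (v : ∀ x : X, TangentSpace I x) : RawForm I X k :=
  fun x => interiorProd (v x) (α x)

/-- The Lie derivative of a form along a vector field. Its value at `x` is computed in the
preferred chart at `x`. -/
def lieDeriv (α : RawForm I X k) (v : ∀ x : X, TangentSpace I x) : RawForm I X k := fun x =>
  lieDerivWithin (𝕜 := ℝ) (E := E) (vectorFieldInChart v x) (α.inChart x) (range I)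
    (extChartAt I x x)

end RawForm

theorem uniqueDiffWithinAt_extChartAt (x : X) :
    UniqueDiffWithinAt ℝ (range I) (extChartAt I x x) :=
  I.uniqueDiffOn _ (extChartAt_target_subset_range x (mem_extChartAt_target x))

variable [IsManifold I ∞ X]

theorem isManifold_one_of_infty : IsManifold I 1 X := IsManifold.of_le (n := ∞) (by simp)

theorem vectorFieldInChart_center (v : ∀ x : X, TangentSpace I x) (x : X) :
    vectorFieldInChart v x (extChartAt I x x) = v x := by
  have := isManifold_one_of_infty (I := I) (X := X)
  have v_congr {p : X} (hp : p = x) : (v p : E) = v x := hp ▸ rfl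
  exact (inverse_apply_of_eq_id (E := E) mfderivWithin_range_extChartAt_symm _).trans
    (v_congr (extChartAt_to_inv x))

namespace RawForm

theorem inChart_center (α : RawForm I X k) (x : X) : α.inChart x (extChartAt I x x) = α x := by
  have := isManifold_one_of_infty (I := I) (X := X)
  exact (compContinuousLinearMap_of_eq_id (E := E) mfderivWithin_range_extChartAt_symm _).trans
    (α.apply_congr (extChartAt_to_inv x))

theorem extD_apply (α : RawForm I X k) (x : X) :
    α.extD x = extDerivWithin (α.inChart x) (range I) (extChartAt I x x) := by
  have := isManifold_one_of_infty (I := I) (X := X)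
  exact compContinuousLinearMap_of_eq_id (E := E) mfderiv_extChartAt_self _

theorem inChart_interior (α : RawForm I X (k + 1)) (v : ∀ x : X, TangentSpace I x) (x₀ : X) {y : E}
    (hy : y ∈ (extChartAt I x₀).target) :
    (α.interior v).inChart x₀ y = (α.inChart x₀ y).curryLeft (vectorFieldInChart v x₀ y) := by
  have := isManifold_one_of_infty (I := I) (X := X)
  ext w
  refine congrArg (α ((extChartAt I x₀).symm y)) (funext fun i => ?_)
  cases i using Fin.cases with
  | zero => exact ((isInvertible_mfderivWithin_extChartAt_symm hy).self_apply_inverse _).symm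
  | succ j => rfl

end RawForm

theorem fderivWithin_extChartAt_comp_symm {x z : X} {y : E} (hy : y ∈ (extChartAt I x).target)
    (hz : (extChartAt I x).symm y ∈ (extChartAt I z).source) :
    fderivWithin ℝ (extChartAt I z ∘ (extChartAt I x).symm) (range I) y =
      (mfderiv I 𝓘(ℝ, E) (extChartAt I z) ((extChartAt I x).symm y)).comp
        (mfderivWithin 𝓘(ℝ, E) I (extChartAt I x).symm (range I) y) := by
  have := isManifold_one_of_infty (I := I) (X := X)
  rw [← mfderivWithin_eq_fderivWithin]
  refine mfderiv_comp_mfderivWithin (I' := I) y (mdifferentiableAt_extChartAt ?_)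
    (mdifferentiableWithinAt_extChartAt_symm hy)
    (I.uniqueDiffOn _ (extChartAt_target_subset_range x hy)).uniqueMDiffWithinAt
  rwa [← extChartAt_source (I := I)]

namespace RawForm

theorem inChart_eq_pullback (α : RawForm I X k) {x z : X} {y : E}
    (hy : y ∈ (extChartAt I x).target)
    (hz : (extChartAt I x).symm y ∈ (extChartAt I z).source) :
    α.inChart x y =
      (α.inChart z ((extChartAt I z ∘ (extChartAt I x).symm) y)).compContinuousLinearMap
        (fderivWithin ℝ (extChartAt I z ∘ (extChartAt I x).symm) (range I) y) := by
  have := isManifold_one_of_infty (I := I) (X := X)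
  have hsymm := mfderivWithin_extChartAt_symm_comp_mfderiv_extChartAt' (I := I) hz
  rw [fderivWithin_extChartAt_comp_symm hy hz]
  ext v
  refine Eq.trans ?_ (congrArg (fun β : E [⋀^Fin k]→L[ℝ] ℝ => β _)
    (α.apply_congr ((extChartAt I z).left_inv hz))).symm
  exact congrArg (α ((extChartAt I x).symm y)) (funext fun i => (DFunLike.congr_fun hsymm _).symm)

theorem inChart_extD {α : RawForm I X k} (hα : α ∈ SmoothForm I X k) (x : X)
    {y : E} (hy : y ∈ (extChartAt I x).target) :
    α.extD.inChart x y = extDerivWithin (α.inChart x) (range I) y := by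
  let z := (extChartAt I x).symm y
  let g : E → E := extChartAt I z ∘ (extChartAt I x).symm
  have hys : y ∈ range I := extChartAt_target_subset_range x hy
  have hpull : α.inChart x =ᶠ[𝓝[range I] y]
      fun y' => (α.inChart z (g y')).compContinuousLinearMap (fderivWithin ℝ g (range I) y') := by
    filter_upwards [extChartAt_target_mem_nhdsWithin_of_mem hy,
      (continuousAt_extChartAt_symm'' hy).continuousWithinAt.preimage_mem_nhdsWithin
        (extChartAt_source_mem_nhds (I := I) z)] with y' hy' hz'
    exact α.inChart_eq_pullback hy' hz'
  have hg : ContDiffWithinAt ℝ ∞ g (range I) y :=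
    contDiffWithinAt_ext_coord_change (I := I) z x ⟨hy, mem_extChartAt_source z⟩
  have hmaps : MapsTo g (range I) (range I) := fun _ _ => mem_range_self _
  have hdiff : DifferentiableWithinAt ℝ (α.inChart z) (range I) (g y) :=
    differentiableWithinAt_inChart hα z
  rw [hpull.extDerivWithin_eq_of_mem hys,
    extDerivWithin_pullback hdiff hg minSmoothness_real_two_le_infty I.uniqueDiffOn
      (I.range_subset_closure_interior hys) hys hmaps,
    fderivWithin_extChartAt_comp_symm hy (mem_extChartAt_source z)]
  rfl

theorem extD_mem {α : RawForm I X k} (hα : α ∈ SmoothForm I X k) :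
    α.extD ∈ SmoothForm I X (k + 1) := by
  intro x
  refine ContDiffOn.congr ?_ fun y hy => inChart_extD hα x hy
  intro y hy
  have hαy : ContDiffWithinAt ℝ ∞ (α.inChart x) (range I) y :=
    (hα x y hy).mono_of_mem_nhdsWithin (extChartAt_target_mem_nhdsWithin_of_mem hy)
  have h : ContDiffWithinAt ℝ ∞ (fderivWithin ℝ (α.inChart x) (range I)) (range I) y :=
    hαy.fderivWithin_right I.uniqueDiffOn (by simp) (extChartAt_target_subset_range x hy)
  exact ((alternatizeUncurryFinCLM ℝ E ℝ (n := k)).contDiff.comp_contDiffWithinAt h).mono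
    (extChartAt_target_subset_range x)

theorem extD_extD {α : RawForm I X k} (hα : α ∈ SmoothForm I X k) : α.extD.extD = 0 := by
  funext x
  have hx := mem_extChartAt_target (I := I) x
  have hxs := extChartAt_target_subset_range x hx
  have hd : α.extD.inChart x =ᶠ[𝓝[range I] extChartAt I x x]
      extDerivWithin (α.inChart x) (range I) := by
    filter_upwards [extChartAt_target_mem_nhdsWithin x] with y hy
    exact inChart_extD hα x hy
  rw [extD_apply, hd.extDerivWithin_eq_of_mem hxs]
  exact extDerivWithin_extDerivWithin_apply
    ((hα x _ hx).mono_of_mem_nhdsWithin (extChartAt_target_mem_nhdsWithin x))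
    minSmoothness_real_two_le_infty I.uniqueDiffOn (I.range_subset_closure_interior hxs) hxs

theorem inChart_interior_eventuallyEq (α : RawForm I X (k + 1)) (v : ∀ x : X, TangentSpace I x)
    (x : X) : (α.interior v).inChart x =ᶠ[𝓝[range I] extChartAt I x x]
      fun y => (α.inChart x y).curryLeft (vectorFieldInChart v x y) := by
  filter_upwards [extChartAt_target_mem_nhdsWithin x] with y hy
  exact α.inChart_interior v x hy

theorem extD_interior_zero (f : RawForm I X 0) (v : ∀ x : X, TangentSpace I x) :
    f.extD.interior v = f.lieDeriv v := by
  funext x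
  have h := extDerivWithin_curryLeft_zero (s := range I) (x := extChartAt I x x)
    (vectorFieldInChart v x) (f.inChart x)
  rw [vectorFieldInChart_center, ← extD_apply] at h
  exact h

end RawForm

variable [CompleteSpace E]

theorem contDiffOn_vectorFieldInChart (v : SmoothVectorField I X) (x : X) :
    ContDiffOn ℝ ∞ (vectorFieldInChart v x) (extChartAt I x).target := by
  have := isManifold_one_of_infty (I := I) (X := X)
  intro y hy
  have h := ContMDiffWithinAt.mpullbackWithin_vectorField_inter (n := ∞) (m := ∞) (t := univ)
    v.contMDiff.contMDiffAt.contMDiffWithinAt (contMDiffWithinAt_extChartAt_symm_range x hy)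
    (isInvertible_mfderivWithin_extChartAt_symm hy) (extChartAt_target_subset_range x hy)
    I.uniqueMDiffOn (by simp)
  rw [preimage_univ, inter_univ] at h
  exact (contMDiffWithinAt_vectorSpace_iff_contDiffWithinAt.1 h).mono
    (extChartAt_target_subset_range x)

theorem differentiableWithinAt_vectorFieldInChart (v : SmoothVectorField I X) (x : X) :
    DifferentiableWithinAt ℝ (vectorFieldInChart v x) (range I) (extChartAt I x x) :=
  ((contDiffOn_vectorFieldInChart v x _ (mem_extChartAt_target x)).differentiableWithinAt
    (by simp)).mono_of_mem_nhdsWithin (extChartAt_target_mem_nhdsWithin x)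

/-- The Lie bracket of smooth vector fields. -/
def SmoothVectorField.lieBracket (v w : SmoothVectorField I X) : SmoothVectorField I X where
  toFun := mlieBracket I v w
  contMDiff_toFun := by
    have : IsManifold I (minSmoothness ℝ 2) X :=
      IsManifold.of_le (n := ∞) minSmoothness_real_two_le_infty
    have : IsManifold I (((⊤ : ℕ∞) : WithTop ℕ∞) + 1) X := inferInstanceAs (IsManifold I ∞ X)
    exact ContDiff.mlieBracket_vectorField (m := ⊤) (n := ⊤) v.contMDiff w.contMDiff (by simp)

theorem SmoothVectorField.lieBracket_apply (v w : SmoothVectorField I X) (x : X) :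
    v.lieBracket w x = lieBracketWithin ℝ (vectorFieldInChart v x) (vectorFieldInChart w x)
      (range I) (extChartAt I x x) := by
  have := isManifold_one_of_infty (I := I) (X := X)
  refine (inverse_apply_of_eq_id (E := E) mfderiv_extChartAt_self _).trans ?_
  rw [preimage_univ, univ_inter]
  rfl

namespace RawForm

theorem interior_mem {α : RawForm I X (k + 1)} (hα : α ∈ SmoothForm I X (k + 1))
    (v : SmoothVectorField I X) : α.interior v ∈ SmoothForm I X k := fun x =>
  (contDiffOn_curryLeft (hα x) (contDiffOn_vectorFieldInChart v x)).congr
    fun _ hy => α.inChart_interior v x hy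

theorem extD_interior_add {α : RawForm I X (k + 1)} (hα : α ∈ SmoothForm I X (k + 1))
    (v : SmoothVectorField I X) : (α.interior v).extD + α.extD.interior v = α.lieDeriv v := by
  funext x
  have h := extDerivWithin_curryLeft_add (differentiableWithinAt_inChart hα x)
    (differentiableWithinAt_vectorFieldInChart v x) (uniqueDiffWithinAt_extChartAt x)
  rw [← (α.inChart_interior_eventuallyEq v x).extDerivWithin_eq_of_mem (mem_range_self _),
    vectorFieldInChart_center, ← extD_apply, ← extD_apply] at h
  exact h

theorem lieDeriv_interior {α : RawForm I X (k + 1)} (hα : α ∈ SmoothForm I X (k + 1))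
    (v w : SmoothVectorField I X) :
    (α.interior w).lieDeriv v = α.interior (v.lieBracket w) + (α.lieDeriv v).interior w := by
  funext x
  have h := lieDerivWithin_curryLeft (a := vectorFieldInChart v x)
    (differentiableWithinAt_inChart hα x) (differentiableWithinAt_vectorFieldInChart w x)
    (uniqueDiffWithinAt_extChartAt x)
  rw [← lieDerivWithin_congr (α.inChart_interior_eventuallyEq w x) (mem_range_self _),
    ← SmoothVectorField.lieBracket_apply, inChart_center, vectorFieldInChart_center] at h
  exact h

end RawForm
end Charts

section FunctionsAsZeroForms

open Set ContinuousAlternatingMap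

variable {E : Type*} [NormedAddCommGroup E] [NormedSpace ℝ E]
  {H : Type*} [TopologicalSpace H] {I : ModelWithCorners ℝ E H}
  {X : Type*} [TopologicalSpace X] [ChartedSpace H X]

namespace RawForm

variable (I) in
/-- A function, viewed as a differential 0-form. -/
def ofFun (f : X → ℝ) : RawForm I X 0 := fun x => constOfIsEmpty ℝ E (Fin 0) (f x)

theorem inChart_ofFun (f : X → ℝ) (x : X) :
    (ofFun I f).inChart x =
      fun y => constOfIsEmpty ℝ E (Fin 0) ((f ∘ (extChartAt I x).symm) y) := by
  funext y
  ext v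
  rfl

theorem inChart_apply_empty (α : RawForm I X 0) (x : X) (y : E) :
    α.inChart x y ![] = α ((extChartAt I x).symm y) ![] :=
  congrArg (α ((extChartAt I x).symm y)) (Subsingleton.elim _ _)

theorem contMDiff_apply_empty [IsManifold I ∞ X] {α : RawForm I X 0} (hα : α ∈ SmoothForm I X 0) :
    ContMDiff I 𝓘(ℝ, ℝ) ∞ fun x => α x ![] := by
  intro x
  have hchart : ContDiffWithinAt ℝ ∞ (α.inChart x) (range I) (extChartAt I x x) :=
    (hα x _ (mem_extChartAt_target x)).mono_of_mem_nhdsWithin (extChartAt_target_mem_nhdsWithin x)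
  have heval : ContDiffWithinAt ℝ ∞ (fun y => α.inChart x y ![]) (range I) (extChartAt I x x) :=
    ContDiff.comp_contDiffWithinAt (g := ContinuousAlternatingMap.apply ℝ E ℝ (![] : Fin 0 → E))
      (ContinuousLinearMap.contDiff _) hchart
  have hcomp : ContMDiffAt I 𝓘(ℝ, ℝ) ∞ (fun z => α.inChart x (extChartAt I x z) ![]) x :=
    heval.contMDiffWithinAt.comp x contMDiffAt_extChartAt fun _ _ => mem_range_self _
  refine hcomp.congr_of_eventuallyEq ?_
  filter_upwards [extChartAt_source_mem_nhds (I := I) x] with z hz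
  rw [inChart_apply_empty, (extChartAt I x).left_inv hz]

theorem ofFun_mem [IsManifold I ∞ X] {f : X → ℝ} (hf : ContMDiff I 𝓘(ℝ, ℝ) ∞ f) :
    ofFun I f ∈ SmoothForm I X 0 := by
  intro x
  rw [inChart_ofFun]
  exact (constOfIsEmptyLIE ℝ E ℝ (Fin 0)).contDiff.comp_contDiffOn
    (hf.comp_contMDiffOn (contMDiffOn_extChartAt_symm x)).contDiffOn

end RawForm

variable [IsManifold I ∞ X]

theorem extD_ofFun_apply {f : X → ℝ} (hf : MDifferentiable I 𝓘(ℝ, ℝ) f) (x : X)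
    (w : TangentSpace I x) : (RawForm.ofFun I f).extD x ![w] = mvfderiv I f x w := by
  rw [RawForm.extD_apply, RawForm.inChart_ofFun,
    extDerivWithin_constOfIsEmpty _ (uniqueDiffWithinAt_extChartAt x)]
  exact (DFunLike.congr_fun (hf x).mfderiv w).symm

variable (I X) in
/-- Smooth 0-forms are smooth functions. -/
def smoothFunctionEquiv : C^∞⟮I, X; 𝓘(ℝ, ℝ), ℝ⟯ ≃ₗ[ℝ] SmoothForm I X 0 where
  toFun f := ⟨RawForm.ofFun I f, RawForm.ofFun_mem f.contMDiff⟩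
  invFun α := ⟨fun x => α.1 x ![], RawForm.contMDiff_apply_empty α.2⟩
  map_add' _ _ := by ext; rfl
  map_smul' _ _ := by ext; rfl
  left_inv _ := rfl
  right_inv α := Subtype.ext <| funext fun x => by
    ext v
    exact congrArg (α.1 x) (Subsingleton.elim _ v)

end FunctionsAsZeroForms

section HamiltonianForms

variable {E : Type*} [NormedAddCommGroup E] [NormedSpace ℝ E]
  {H : Type*} [TopologicalSpace H] {I : ModelWithCorners ℝ E H}
  {X : Type*} [TopologicalSpace X] [ChartedSpace H X] {k : ℕ}

namespace RawForm

theorem interior_neg (α : RawForm I X (k + 1)) (v : ∀ x : X, TangentSpace I x) :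
    (-α).interior v = -α.interior v :=
  rfl

theorem interior_zero (v : ∀ x : X, TangentSpace I x) :
    (0 : RawForm I X (k + 1)).interior v = 0 :=
  rfl

theorem interior_vectorField_add (α : RawForm I X (k + 1)) (v w : ∀ x : X, TangentSpace I x) :
    α.interior (v + w) = α.interior v + α.interior w :=
  funext fun x => interiorProd_add (v x) (w x) (α x)

theorem interior_vectorField_smul (c : ℝ) (α : RawForm I X (k + 1))
    (v : ∀ x : X, TangentSpace I x) : α.interior (c • v) = c • α.interior v :=
  funext fun x => interiorProd_smul c (v x) (α x)

theorem interior_vectorField_zero (α : RawForm I X (k + 1)) :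
    α.interior (0 : ∀ x : X, TangentSpace I x) = 0 := by
  have h := α.interior_vectorField_smul 0 0
  rwa [zero_smul, zero_smul] at h

theorem interior_swap (α : RawForm I X (k + 2)) (v w : ∀ x : X, TangentSpace I x) :
    (α.interior v).interior w = -(α.interior w).interior v :=
  funext fun x => curryLeft_curryLeft_swap (E := E) (α x) (v x) (w x)

theorem extD_neg (α : RawForm I X k) : (-α).extD = -α.extD := by
  have neg_eq_smul {n : ℕ} (β : RawForm I X n) : -β = (-1 : ℝ) • β := (neg_one_smul ℝ β).symm
  rw [neg_eq_smul, extD_smul, ← neg_eq_smul]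

end RawForm

variable [IsManifold I ∞ X]

theorem isHamiltonianVF_iff {Ω : RawForm I X (k + 2)} {F : RawForm I X k}
    {v : SmoothVectorField I X} : IsHamiltonianVF Ω F v ↔ F.extD = -Ω.interior v :=
  funext_iff.symm

variable {Ω : RawForm I X (k + 2)}

theorem extD_eq_neg_interior_hamVF (F : Ham Ω) : F.1.extD = -Ω.interior (hamVF F) :=
  isHamiltonianVF_iff.1 (hamVF_spec F)

theorem extD_interior_hamVF (F : Ham Ω) : (Ω.interior (hamVF F)).extD = 0 := by
  rw [← neg_neg (Ω.interior _), ← extD_eq_neg_interior_hamVF, RawForm.extD_neg,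
    RawForm.extD_extD F.2.1, neg_zero]

/-- Taking the Hamiltonian vector field, as a linear map. -/
def hamVFLinear (hΩ : IsPlectic (k + 1) Ω) : Ham Ω →ₗ[ℝ] SmoothVectorField I X where
  toFun := hamVF
  map_add' F G := by
    refine (eq_hamVF hΩ _ _ (isHamiltonianVF_iff.2 ?_)).symm
    rw [Submodule.coe_add, RawForm.extD_add F.2.1 G.2.1, ContMDiffSection.coe_add,
      RawForm.interior_vectorField_add, extD_eq_neg_interior_hamVF, extD_eq_neg_interior_hamVF,
      neg_add]
  map_smul' c F := by
    refine (eq_hamVF hΩ _ _ (isHamiltonianVF_iff.2 ?_)).symm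
    rw [Submodule.coe_smul, RawForm.extD_smul, RingHom.id_apply, ContMDiffSection.coe_smul,
      RawForm.interior_vectorField_smul, extD_eq_neg_interior_hamVF, smul_neg]

variable [CompleteSpace E]

variable (I X k) in
/-- The interior product `v ↦ α ↦ ι_v α` of smooth forms with smooth vector fields. -/
def contraction : SmoothVectorField I X →ₗ[ℝ] SmoothForm I X (k + 1) →ₗ[ℝ] SmoothForm I X k :=
  LinearMap.mk₂ ℝ (fun v α => ⟨α.1.interior v, RawForm.interior_mem α.2 v⟩)
    (fun v w α => Subtype.ext (α.1.interior_vectorField_add v w))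
    (fun c v α => Subtype.ext (α.1.interior_vectorField_smul c v))
    (fun _ _ _ => rfl) (fun _ _ _ => rfl)

theorem lieDeriv_hamVF (hΩ : IsPlectic (k + 1) Ω) (F : Ham Ω) : Ω.lieDeriv (hamVF F) = 0 := by
  rw [← RawForm.extD_interior_add hΩ.smooth, extD_interior_hamVF, hΩ.closed,
    RawForm.interior_zero, add_zero]

theorem lieDeriv_hamVF_interior (hΩ : IsPlectic (k + 1) Ω) (F : Ham Ω)
    (w : SmoothVectorField I X) :
    (Ω.interior w).lieDeriv (hamVF F) = Ω.interior ((hamVF F).lieBracket w) := by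
  rw [RawForm.lieDeriv_interior hΩ.smooth, lieDeriv_hamVF hΩ, RawForm.interior_zero, add_zero]

theorem isHamiltonianVF_interior_interior (hΩ : IsPlectic (k + 1) Ω) (F G : Ham Ω) :
    IsHamiltonianVF Ω ((Ω.interior (hamVF F)).interior (hamVF G))
      ((hamVF F).lieBracket (hamVF G)) := by
  have hG := RawForm.extD_interior_add (RawForm.interior_mem hΩ.smooth (hamVF G)) (hamVF F)
  rw [extD_interior_hamVF, RawForm.interior_zero, add_zero, lieDeriv_hamVF_interior hΩ] at hG
  rw [isHamiltonianVF_iff, RawForm.interior_swap, RawForm.extD_neg, hG]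

/-- The form `ι_{v_G} ι_{v_F} Ω`, as a bilinear function of `F` and `G`. -/
def semiBracketForm (hΩ : IsPlectic (k + 1) Ω) : Ham Ω →ₗ[ℝ] Ham Ω →ₗ[ℝ] SmoothForm I X k :=
  ((contraction I X k).flip ∘ₗ (contraction I X (k + 1)).flip ⟨Ω, hΩ.smooth⟩ ∘ₗ
    hamVFLinear hΩ).compl₂ (hamVFLinear hΩ)

/-- The semi-bracket `{F, G} = ι_{v_G} ι_{v_F} Ω` of Hamiltonian forms. -/
def semiBracket (hΩ : IsPlectic (k + 1) Ω) : Ham Ω →ₗ[ℝ] Ham Ω →ₗ[ℝ] Ham Ω where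
  toFun F := ((SmoothForm I X k).subtype ∘ₗ semiBracketForm hΩ F).codRestrict (Ham Ω) fun G =>
    ⟨(semiBracketForm hΩ F G).2, _, isHamiltonianVF_interior_interior hΩ F G⟩
  map_add' F F' := LinearMap.ext fun G => Subtype.ext
    (congrArg (SmoothForm I X k).subtype ((semiBracketForm hΩ).map_add₂ F F' G))
  map_smul' c F := LinearMap.ext fun G => Subtype.ext
    (congrArg (SmoothForm I X k).subtype ((semiBracketForm hΩ).map_smul₂ c F G))

theorem coe_semiBracket (hΩ : IsPlectic (k + 1) Ω) (F G : Ham Ω) :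
    (semiBracket hΩ F G).1 = (Ω.interior (hamVF F)).interior (hamVF G) :=
  rfl

theorem hamVF_semiBracket (hΩ : IsPlectic (k + 1) Ω) (F G : Ham Ω) :
    hamVF (semiBracket hΩ F G) = (hamVF F).lieBracket (hamVF G) :=
  (eq_hamVF hΩ (semiBracket hΩ F G) _ (isHamiltonianVF_interior_interior hΩ F G)).symm

theorem semiBracket_swap (hΩ : IsPlectic (k + 1) Ω) (F G : Ham Ω) :
    semiBracket hΩ F G = -semiBracket hΩ G F :=
  Subtype.ext (Ω.interior_swap _ _)

theorem lieDeriv_semiBracket (hΩ : IsPlectic (k + 1) Ω) (F G K : Ham Ω) :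
    (semiBracket hΩ G K).1.lieDeriv (hamVF F) =
      (semiBracket hΩ (semiBracket hΩ F G) K).1 + (semiBracket hΩ G (semiBracket hΩ F K)).1 := by
  rw [coe_semiBracket hΩ G K, RawForm.lieDeriv_interior (RawForm.interior_mem hΩ.smooth _),
    lieDeriv_hamVF_interior hΩ, coe_semiBracket, coe_semiBracket, hamVF_semiBracket,
    hamVF_semiBracket, add_comm]

end HamiltonianForms

section Jacobi

variable {E : Type*} [NormedAddCommGroup E] [NormedSpace ℝ E]
  {H : Type*} [TopologicalSpace H] {I : ModelWithCorners ℝ E H}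
  {X : Type*} [TopologicalSpace X] [ChartedSpace H X] [IsManifold I ∞ X] {k : ℕ}
  {Ω : RawForm I X (k + 3)}

theorem isHamiltonianVF_extD_zero (Ω : RawForm I X (k + 3)) {α : RawForm I X k}
    (hα : α ∈ SmoothForm I X k) : IsHamiltonianVF Ω α.extD 0 := by
  rw [isHamiltonianVF_iff, RawForm.extD_extD hα, ContMDiffSection.coe_zero,
    RawForm.interior_vectorField_zero, neg_zero]

variable (Ω) in
/-- The exterior derivative, from smooth forms to Hamiltonian forms: an exact form has the
Hamiltonian vector field `0`. -/
def extDHam : SmoothForm I X k →ₗ[ℝ] Ham (k := k + 1) Ω where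
  toFun α := ⟨α.1.extD, RawForm.extD_mem α.2, 0, isHamiltonianVF_extD_zero Ω α.2⟩
  map_add' α β := Subtype.ext (RawForm.extD_add α.2 β.2)
  map_smul' c α := Subtype.ext (RawForm.extD_smul c α.1)

theorem hamVF_extDHam (hΩ : IsPlectic (k + 2) Ω) (α : SmoothForm I X k) :
    hamVF (extDHam Ω α) = 0 :=
  (eq_hamVF hΩ (extDHam Ω α) _ (isHamiltonianVF_extD_zero Ω α.2)).symm

variable [CompleteSpace E]

theorem semiBracket_extDHam (hΩ : IsPlectic (k + 2) Ω) (F : Ham (k := k + 1) Ω)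
    (α : SmoothForm I X k) : semiBracket hΩ F (extDHam Ω α) = 0 := by
  refine Subtype.ext ?_
  rw [coe_semiBracket, hamVF_extDHam hΩ, ContMDiffSection.coe_zero,
    RawForm.interior_vectorField_zero]
  rfl

/-- The Jacobiator `-ι_{v_F} ι_{v_G} ι_{v_K} Ω` of the semi-bracket, with values in forms. It is
encoded as `ι_{v_F} {G, K}`, which is the same form since interior products anticommute. -/
def jacobiatorForm (hΩ : IsPlectic (k + 2) Ω) : Ham (k := k + 1) Ω →ₗ[ℝ]
    Ham (k := k + 1) Ω →ₗ[ℝ] Ham (k := k + 1) Ω →ₗ[ℝ] SmoothForm I X k where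
  toFun F := (semiBracketForm hΩ).compr₂ (contraction I X k (hamVFLinear hΩ F))
  map_add' F F' := by rw [map_add, map_add]; rfl
  map_smul' c F := by rw [map_smul, map_smul]; rfl

theorem coe_jacobiatorForm (hΩ : IsPlectic (k + 2) Ω) (F G K : Ham (k := k + 1) Ω) :
    (jacobiatorForm hΩ F G K).1 = (semiBracket hΩ G K).1.interior (hamVF F) :=
  rfl

theorem jacobiatorForm_swap_right (hΩ : IsPlectic (k + 2) Ω) (F G K : Ham (k := k + 1) Ω) :
    jacobiatorForm hΩ F G K = -jacobiatorForm hΩ F K G := by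
  refine Subtype.ext ?_
  rw [coe_jacobiatorForm, semiBracket_swap]
  rfl

theorem jacobiatorForm_swap_left (hΩ : IsPlectic (k + 2) Ω) (F G K : Ham (k := k + 1) Ω) :
    jacobiatorForm hΩ F G K = -jacobiatorForm hΩ G F K := by
  rw [jacobiatorForm_swap_right hΩ F, jacobiatorForm_swap_right hΩ G]
  refine Subtype.ext (congrArg Neg.neg ?_)
  exact RawForm.interior_swap (Ω.interior (hamVF K)) (hamVF G) (hamVF F)

theorem jacobiatorForm_extDHam (hΩ : IsPlectic (k + 2) Ω) (F G : Ham (k := k + 1) Ω)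
    (α : SmoothForm I X k) : jacobiatorForm hΩ F G (extDHam Ω α) = 0 := by
  refine Subtype.ext ?_
  rw [coe_jacobiatorForm, semiBracket_extDHam]
  rfl

theorem lieDeriv_jacobiatorForm (hΩ : IsPlectic (k + 2) Ω) (F G K L : Ham (k := k + 1) Ω) :
    (jacobiatorForm hΩ G K L).1.lieDeriv (hamVF F) =
      (jacobiatorForm hΩ (semiBracket hΩ F G) K L + jacobiatorForm hΩ G (semiBracket hΩ F K) L +
        jacobiatorForm hΩ G K (semiBracket hΩ F L)).1 := by
  rw [coe_jacobiatorForm, RawForm.lieDeriv_interior (semiBracket hΩ K L).2.1,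
    lieDeriv_semiBracket, ← hamVF_semiBracket hΩ, add_assoc]
  rfl

theorem semiBracket_jacobi (hΩ : IsPlectic (k + 2) Ω) (F G K : Ham (k := k + 1) Ω) :
    semiBracket hΩ F (semiBracket hΩ G K) + extDHam Ω (jacobiatorForm hΩ F G K) =
      semiBracket hΩ (semiBracket hΩ F G) K + semiBracket hΩ G (semiBracket hΩ F K) := by
  have interior_extD : (semiBracket hΩ G K).1.extD.interior (hamVF F) =
      (semiBracket hΩ F (semiBracket hΩ G K)).1 := by
    rw [extD_eq_neg_interior_hamVF, RawForm.interior_neg, coe_semiBracket hΩ F,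
      ← RawForm.interior_swap]
  refine Subtype.ext (Eq.trans ?_ (lieDeriv_semiBracket hΩ F G K))
  rw [← RawForm.extD_interior_add (semiBracket hΩ G K).2.1, interior_extD]
  exact add_comm _ _

end Jacobi

section Algebra

variable {K L₀ L₁ : Type*} [Field K] [AddCommGroup L₀] [Module K L₀] [AddCommGroup L₁] [Module K L₁]

/-- The Lie 2-algebra with alternator `0` given by an antisymmetric bracket on 0-chains, a bracket
`0` between 0-chains and 1-chains, and an antisymmetric Jacobiator. -/
def LieTwoAlgebra.ofSkewBracket (d : L₁ →ₗ[K] L₀) (br : L₀ →ₗ[K] L₀ →ₗ[K] L₀)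
    (J : L₀ →ₗ[K] L₀ →ₗ[K] L₀ →ₗ[K] L₁) (br_swap : ∀ x y, br x y = -br y x)
    (br_d : ∀ x f, br x (d f) = 0) (J_swap_left : ∀ x y z, J x y z = -J y x z)
    (J_swap_right : ∀ x y z, J x y z = -J x z y) (J_d : ∀ x y f, J x y (d f) = 0)
    (jacobi : ∀ x y z, br x (br y z) + d (J x y z) = br (br x y) z + br y (br x z))
    (coherence : ∀ w x y z, J (br w y) x z + J w (br x y) z =
      J (br w x) y z + (J w (br x z) y + J (br w z) x y + J w x (br y z))) :
    LieTwoAlgebra K L₀ L₁ where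
  d := d
  br := br
  brR := 0
  brL := 0
  d_brR x f := by simp [br_d]
  d_brL f x := by simp [br_swap (d f), br_d]
  brR_d := by simp
  S := 0
  S_homotopy x y := by simpa using br_swap x y
  S_homotopy_right := by simp
  S_homotopy_left := by simp
  J := J
  J_homotopy := jacobi
  J_homotopy_right x y f := by simp [J_d]
  J_homotopy_mid x f z := by simp [J_swap_right x (d f), J_d]
  J_homotopy_left f y z := by simp [J_swap_left (d f), J_swap_right y (d f), J_d]
  J_swap_left := J_swap_left
  J_swap_right := J_swap_right
  jacobiator_coherence w x y z := by simpa using coherence w x y z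
  alternator_jacobiator_left x y z := by simpa using J_swap_left y x z
  alternator_jacobiator_right x y z := by simp [J_swap_right x z]
  alternator_symm := by simp

end Algebra

section SemistrictLieTwoAlgebra

variable {E : Type*} [NormedAddCommGroup E] [NormedSpace ℝ E] [CompleteSpace E]
  {H : Type*} [TopologicalSpace H] {I : ModelWithCorners ℝ E H}
  {X : Type*} [TopologicalSpace X] [ChartedSpace H X] [IsManifold I ∞ X] {Ω : RawForm I X 3}

theorem jacobiatorForm_add_lieDeriv (hΩ : IsPlectic 2 Ω) (F G K L : Ham (k := 1) Ω) :
    (jacobiatorForm hΩ F G (semiBracket hΩ K L)).1 +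
      (jacobiatorForm hΩ G K L).1.lieDeriv (hamVF F) =
      (jacobiatorForm hΩ F (semiBracket hΩ G K) L +
        jacobiatorForm hΩ F K (semiBracket hΩ G L)).1 := by
  rw [← RawForm.extD_interior_zero]
  exact congrArg (fun A => A.1.interior (hamVF F)) (semiBracket_jacobi hΩ G K L)

theorem jacobiatorForm_coherence (hΩ : IsPlectic 2 Ω) (F G K L : Ham (k := 1) Ω) :
    jacobiatorForm hΩ (semiBracket hΩ F K) G L + jacobiatorForm hΩ F (semiBracket hΩ G K) L =
      jacobiatorForm hΩ (semiBracket hΩ F G) K L +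
        (jacobiatorForm hΩ F (semiBracket hΩ G L) K + jacobiatorForm hΩ (semiBracket hΩ F L) G K +
          jacobiatorForm hΩ F G (semiBracket hΩ K L)) := by
  have h := jacobiatorForm_add_lieDeriv hΩ F G K L
  rw [lieDeriv_jacobiatorForm, ← Submodule.coe_add, SetLike.coe_eq_coe,
    jacobiatorForm_swap_left hΩ G (semiBracket hΩ F K),
    jacobiatorForm_swap_right hΩ F K (semiBracket hΩ G L),
    jacobiatorForm_swap_right hΩ G K (semiBracket hΩ F L),
    jacobiatorForm_swap_left hΩ G (semiBracket hΩ F L)] at h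
  linear_combination (norm := module) -h

/-- The Jacobiator of the semi-bracket, with values in functions. -/
def jacobiator (hΩ : IsPlectic 2 Ω) : Ham (k := 1) Ω →ₗ[ℝ] Ham (k := 1) Ω →ₗ[ℝ]
    Ham (k := 1) Ω →ₗ[ℝ] C^∞⟮I, X; 𝓘(ℝ, ℝ), ℝ⟯ :=
  (smoothFunctionEquiv I X).symm.congrRight.congrRight.congrRight (jacobiatorForm hΩ)

/-- The semistrict Lie 2-algebra of a 2-plectic manifold. -/
def semistrictLieTwoAlgebra (hΩ : IsPlectic 2 Ω) :
    LieTwoAlgebra ℝ (Ham (k := 1) Ω) C^∞⟮I, X; 𝓘(ℝ, ℝ), ℝ⟯ :=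
  let e := smoothFunctionEquiv I X
  .ofSkewBracket (extDHam Ω ∘ₗ e.toLinearMap) (semiBracket hΩ) (jacobiator hΩ)
    (br_swap := semiBracket_swap hΩ)
    (br_d := fun F f => semiBracket_extDHam hΩ F (e f))
    (J_swap_left := fun F G K =>
      (congrArg e.symm (jacobiatorForm_swap_left hΩ F G K)).trans (map_neg e.symm _))
    (J_swap_right := fun F G K =>
      (congrArg e.symm (jacobiatorForm_swap_right hΩ F G K)).trans (map_neg e.symm _))
    (J_d := fun F G f =>
      (congrArg e.symm (jacobiatorForm_extDHam hΩ F G (e f))).trans (map_zero e.symm))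
    (jacobi := fun F G K => by
      rw [← semiBracket_jacobi hΩ F G K]
      exact congrArg (_ + extDHam Ω ·) (e.apply_symm_apply _))
    (coherence := fun F G K L => by
      have h := congrArg e.symm (jacobiatorForm_coherence hΩ F G K L)
      simp only [map_add] at h
      exact h)

end SemistrictLieTwoAlgebra

end

theorem theorem4p4_general {E : Type*} [NormedAddCommGroup E] [NormedSpace ℝ E] [CompleteSpace E]
    {H : Type*} [TopologicalSpace H] (I : ModelWithCorners ℝ E H)
    (X : Type*) [TopologicalSpace X] [ChartedSpace H X] [IsManifold I ∞ X]
    (Ω : RawForm I X 3) (hΩ : IsPlectic 2 Ω) :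
    ∃ L : LieTwoAlgebra ℝ (Ham (k := 1) Ω) C^∞⟮I, X; 𝓘(ℝ, ℝ), ℝ⟯,
      (∀ (f : C^∞⟮I, X; 𝓘(ℝ, ℝ), ℝ⟯) (x : X) (w : TangentSpace I x),
        (L.d f).1 x ![w] = mvfderiv I f x w) ∧
      (∀ (F G : Ham (k := 1) Ω) (x : X),
        (L.br F G).1 x = interiorProd (hamVF G x) (interiorProd (hamVF F x) (Ω x))) ∧
      (∀ (F : Ham (k := 1) Ω) (f : C^∞⟮I, X; 𝓘(ℝ, ℝ), ℝ⟯), L.brR F f = 0 ∧ L.brL f F = 0) ∧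
      (∀ F G : Ham (k := 1) Ω, L.br F G = -L.br G F) ∧
      L.IsSemistrict ∧
      (∀ (F G K : Ham (k := 1) Ω) (x : X),
        L.J F G K x =
          -(interiorProd (hamVF F x) (interiorProd (hamVF G x)
            (interiorProd (hamVF K x) (Ω x)))) ![]) := by
  refine ⟨semistrictLieTwoAlgebra hΩ, fun f x w => ?_, fun _ _ _ => rfl,
    fun _ _ => ⟨rfl, rfl⟩, semiBracket_swap hΩ, fun _ _ => rfl, fun F G K x => ?_⟩
  · exact extD_ofFun_apply (f.contMDiff.mdifferentiable (by simp)) x w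
  · exact congrArg (fun α => α.1 x ![]) (jacobiatorForm_swap_right hΩ F G K)

/-- `F.1 x` is the value at the point `x` of the 1-form underlying `F : Ham Ω`. The Jacobiator is
a 0-form, which is identified with a function by evaluating it on the empty tuple `![]`. -/
theorem theorem4p4 {E : Type*} [NormedAddCommGroup E] [NormedSpace ℝ E] [FiniteDimensional ℝ E]
    {H : Type*} [TopologicalSpace H] (I : ModelWithCorners ℝ E H) [I.Boundaryless]
    (X : Type*) [TopologicalSpace X] [ChartedSpace H X] [IsManifold I ∞ X]
    (Ω : RawForm I X 3) (hΩ : IsPlectic 2 Ω) :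
    ∃ L : LieTwoAlgebra ℝ (Ham (k := 1) Ω) C^∞⟮I, X; 𝓘(ℝ, ℝ), ℝ⟯,
      (∀ (f : C^∞⟮I, X; 𝓘(ℝ, ℝ), ℝ⟯) (x : X) (w : TangentSpace I x),
        (L.d f).1 x ![w] = mvfderiv I f x w) ∧
      (∀ (F G : Ham (k := 1) Ω) (x : X),
        (L.br F G).1 x = interiorProd (hamVF G x) (interiorProd (hamVF F x) (Ω x))) ∧
      (∀ (F : Ham (k := 1) Ω) (f : C^∞⟮I, X; 𝓘(ℝ, ℝ), ℝ⟯), L.brR F f = 0 ∧ L.brL f F = 0) ∧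
      (∀ F G : Ham (k := 1) Ω, L.br F G = -L.br G F) ∧
      L.IsSemistrict ∧
      (∀ (F G K : Ham (k := 1) Ω) (x : X),
        L.J F G K x =
          -(interiorProd (hamVF F x) (interiorProd (hamVF G x)
            (interiorProd (hamVF K x) (Ω x)))) ![]) := by
  have := FiniteDimensional.complete ℝ E
  exact theorem4p4_general I X Ω hΩ
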